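/- **Gasket and vertices.** Let $SG(n)$ be the two-dimensional Sierpinski gasket graph: $SG(0)$ is an upward equilateral triangle with unit sides, and $SG(n+1)$ is the union of three translated copies of $SG(n)$ placed at the lower left, the right and the top, neighbouring copies sharing a corner. All stages have the same leftmost vertex $o$; $a_n$ and $b_n$ are the rightmost and topmost vertices of $SG(n)$. For $m\ge 0$ let the triangle with address $(m)$ be the triangle with corners $o,a_{m+1},b_{m+1}$. Given a triangle with address $(m,\gamma_2,\dots,\gamma_{s-1})$, its lower left, right and top half-size triangles have addresses $(m,\gamma_2,\dots,\gamma_{s-1},\gamma_s)$ with $\gamma_s=0,1,2$ respectively. For $1\le s\le m+1$ and $\gamma=(m,\gamma_2,\dots,\gamma_s)$, let $a_\gamma,b_\gamma,c_\gamma$ be the midpoints of the bottom, left and right sides of the triangle with address $\gamma$; they are vertices of $SG(m+1)$. **Degree probabilities.** For a vertex $x$ of $SG(n)$, let $F_j(n,x)$ be the proportion of the spanning trees of $SG(n)$ that have exactly $j$ edges at $x$. Let $G_j(n,x)$ be the same proportion among the spanning subgraphs of $SG(n)$ consisting of exactly two trees, one containing $b_n$ and the other containing $o$ and $a_n$, and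 $H_j(n,x)$ the same proportion among the spanning subgraphs consisting of exactly three trees, with $o,a_n,b_n$ in three different ones. For $\gamma=(n-1,\gamma_2,\dots,\gamma_s)$ let $B_j(n,\gamma)$ be the $3\times5$ matrix whose rows, indexed by $x=a,b,c$ in this order, are $$\bigl(F_j(n,x_\gamma),\;G_j(n,x_\gamma),\;G_j(n,\tilde x_\gamma),\;G_j(n,\hat x_\gamma),\;H_j(n,x_\gamma)\bigr),$$ where $\tilde x_\gamma$ is the reflection of $x_\gamma$ that fixes $o$ and exchanges $a_n$ and $b_n$, and $\hat x_\gamma$ the reflection that fixes $a_n$ and exchanges $o$ and $b_n$. Put $$R=\begin{pmatrix}\frac23&\frac35&\frac1{10}&\frac35&\frac6{25}\\ \frac16&\frac3{10}&\frac1{10}&\frac1{10}&\frac7{50}\\ 0&0&\frac25&0&\frac6{25}\\ \frac16&\frac1{10}&\frac1{10}&\frac3{10}&\frac7{50}\\ 0&0&\frac3{10}&0&\frac6{25}\end{pmatrix},\qquad e_1=(1,0,0,0,0)^T,$$ let $E_1$ be the $5\times5$ identity matrix, $E_0$ the permutation matrix exchanging the third and fourth coordinates, and $E_2$ the permutation matrix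 exchanging the second and third coordinates. **Reduced address.** For $\gamma=(n,1,\gamma_3,\gamma_4,\dots,\gamma_s)$ put $\gamma^{t}=(n-1,1,\kappa_t(\gamma_4),\dots,\kappa_t(\gamma_s))$, where $t=\gamma_3$; here $\kappa_0$ exchanges the digits $0$ and $1$, $\kappa_1$ is the identity, and $\kappa_2$ exchanges $1$ and $2$. Let $P_t$ be the $3\times3$ permutation matrix acting on the rows indexed by $a,b,c$: $P_0$ exchanges the rows $b$ and $c$, $P_1$ is the identity, and $P_2$ exchanges the rows $a$ and $b$. **Proposition.** Let $n\ge2$, $3\le s\le n+1$, $\gamma=(n,1,\gamma_3,\dots,\gamma_s)$ with $\gamma_k\in\{0,1,2\}$ for $3\le k\le s$, and $j\in\{1,2,3,4\}$. Then $$\begin{pmatrix}F_j(n+1,a_\gamma)\\F_j(n+1,b_\gamma)\\F_j(n+1,c_\gamma)\end{pmatrix}=P_{\gamma_3}\,B_j\bigl(n,\gamma^{\gamma_3}\bigr)\,E_{\gamma_3}\,R\,e_1 .$$ -/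

import Mathlib

/-! Points of the triangular lattice are written in oblique coordinates: `(x, y)` stands for
`x • u + y • v`, where `u` and `v` are unit vectors at angle `π / 3`. -/

namespace Gasket

/-- The vertex set of `SG(n)`: a triangle for `n = 0`; stage `n + 1` is made of three translated
copies of stage `n`, with lower left corners `o = (0, 0)`, `a_n = (2 ^ n, 0)`, `b_n = (0, 2 ^ n)`. -/
def verts : ℕ → Set (ℤ × ℤ)
  | 0 => {(0, 0), (1, 0), (0, 1)}
  | n + 1 => verts n ∪ (fun p => p + (2 ^ n, 0)) '' verts n ∪ (fun p => p + (0, 2 ^ n)) '' verts n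

/-- The Sierpinski gasket `SG(n)`, as a graph drawn on the lattice. Its edges join points of
`verts n` only. -/
def SG : ℕ → SimpleGraph (ℤ × ℤ)
  | 0 => SimpleGraph.fromEdgeSet {s((0, 0), (1, 0)), s((0, 0), (0, 1)), s((1, 0), (0, 1))}
  | n + 1 => SG n ⊔ (SG n).map (fun p => p + (2 ^ n, 0)) ⊔ (SG n).map (fun p => p + (0, 2 ^ n))

/-- The leftmost vertex. -/
def o : ℤ × ℤ := (0, 0)

/-- The rightmost vertex `a_n` of `SG(n)`. -/
def cornerA (n : ℕ) : ℤ × ℤ := (2 ^ n, 0)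

/-- The topmost vertex `b_n` of `SG(n)`. -/
def cornerB (n : ℕ) : ℤ × ℤ := (0, 2 ^ n)

/-- `H` is (the edge set of) a spanning tree of `SG(n)`. -/
def IsSpanningTree (n : ℕ) (H : SimpleGraph (ℤ × ℤ)) : Prop :=
  H ≤ SG n ∧ (H.induce (verts n)).IsTree

/-- `H` is a spanning subgraph of `SG(n)` consisting of exactly `k` trees. -/
def IsSpanningForest (n k : ℕ) (H : SimpleGraph (ℤ × ℤ)) : Prop :=
  H ≤ SG n ∧ (H.induce (verts n)).IsAcyclic ∧
    Nat.card (H.induce (verts n)).ConnectedComponent = k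

/-- A spanning subgraph with two trees, one containing `b_n`, the other one `o` and `a_n`. -/
def IsTwoForest (n : ℕ) (H : SimpleGraph (ℤ × ℤ)) : Prop :=
  IsSpanningForest n 2 H ∧ H.Reachable o (cornerA n) ∧ ¬ H.Reachable o (cornerB n)

/-- A spanning subgraph with three trees, `o`, `a_n` and `b_n` being in different ones. -/
def IsThreeForest (n : ℕ) (H : SimpleGraph (ℤ × ℤ)) : Prop :=
  IsSpanningForest n 3 H ∧ ¬ H.Reachable o (cornerA n) ∧ ¬ H.Reachable o (cornerB n) ∧
    ¬ H.Reachable (cornerA n) (cornerB n)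

/-- The number of edges of `H` at `x`. -/
noncomputable def deg (H : SimpleGraph (ℤ × ℤ)) (x : ℤ × ℤ) : ℕ := (H.neighborSet x).ncard

/-- `F_j(n, x) = f_j(n, x) / f(n)`. -/
noncomputable def F (j n : ℕ) (x : ℤ × ℤ) : ℚ :=
  ({H | IsSpanningTree n H ∧ deg H x = j}.ncard : ℚ) / ({H | IsSpanningTree n H}.ncard : ℚ)

/-- `G_j(n, x) = g_j(n, x) / g(n)`. -/
noncomputable def G (j n : ℕ) (x : ℤ × ℤ) : ℚ :=
  ({H | IsTwoForest n H ∧ deg H x = j}.ncard : ℚ) / ({H | IsTwoForest n H}.ncard : ℚ)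

/-- `H_j(n, x) = h_j(n, x) / h(n)`. -/
noncomputable def H (j n : ℕ) (x : ℤ × ℤ) : ℚ :=
  ({K | IsThreeForest n K ∧ deg K x = j}.ncard : ℚ) / ({K | IsThreeForest n K}.ncard : ℚ)

/-- The offset, for a triangle of side two, of the lower left corner of its lower left (`0`),
right (`1`) and top (`2`) half-size triangle. -/
def subOffset : Fin 3 → ℤ × ℤ := ![(0, 0), (1, 0), (0, 1)]

/-- The midpoints of the sides of a triangle of side two with lower left corner `(0, 0)`:
`a` (index `0`) on the bottom side, `b` (index `1`) on the left, `c` (index `2`) on the right. -/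
def sideMid : Fin 3 → ℤ × ℤ := ![(1, 0), (0, 1), (1, 1)]

/-- The vertex `x_γ`, with letter `x` (`0`, `1`, `2` stand for `a`, `b`, `c`) and subscript
`γ = (m, γ₂, …, γ_s)`. The triangle named by `(m)` is `SG(m + 1)`, of side `2 ^ (m + 1)`, each
further component selects one of the three half-size triangles of the triangle reached so far, and
`a_γ`, `b_γ`, `c_γ` are the side midpoints of the triangle reached at the end.
This needs `s ≤ m + 1`; the last case is never used then. -/
def vertex (x : Fin 3) : ℕ → List (Fin 3) → ℤ × ℤ
  | m, [] => (2 ^ m : ℤ) • sideMid x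
  | m + 1, d :: γ => (2 ^ (m + 1) : ℤ) • subOffset d + vertex x m γ
  | 0, _ :: _ => 0

/-- Reflection in the line through `o` and `c_0`. -/
def tilde (p : ℤ × ℤ) : ℤ × ℤ := (p.2, p.1)

/-- Reflection in the line through `a_n` and `b_{n-1}`, which exchanges `o` and `b_n`. -/
def hat (n : ℕ) (p : ℤ × ℤ) : ℤ × ℤ := (p.1, 2 ^ n - p.1 - p.2)

/-- The matrix `B_j(N, γ)` for `γ = (m, γ₂, …, γ_s)`: the rows belong to `a_γ`, `b_γ`, `c_γ`. -/
noncomputable def B (j N m : ℕ) (γ : List (Fin 3)) : Matrix (Fin 3) (Fin 5) ℚ :=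
  Matrix.of fun x =>
    let v := vertex x m γ
    ![F j N v, G j N v, G j N (tilde v), G j N (hat (m + 1) v), H j N v]

def R : Matrix (Fin 5) (Fin 5) ℚ :=
  !![2/3, 3/5,  1/10, 3/5,  6/25;
     1/6, 3/10, 1/10, 1/10, 7/50;
     0,   0,    2/5,  0,    6/25;
     1/6, 1/10, 1/10, 3/10, 7/50;
     0,   0,    3/10, 0,    6/25]

/-- The matrices `E_0`, `E_1`, `E_2`. -/
def E : Fin 3 → Matrix (Fin 5) (Fin 5) ℚ :=
  ![!![1, 0, 0, 0, 0;
       0, 1, 0, 0, 0;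
       0, 0, 0, 1, 0;
       0, 0, 1, 0, 0;
       0, 0, 0, 0, 1],
    1,
    !![1, 0, 0, 0, 0;
       0, 0, 1, 0, 0;
       0, 1, 0, 0, 0;
       0, 0, 0, 1, 0;
       0, 0, 0, 0, 1]]

def e₁ : Fin 5 → ℚ := ![1, 0, 0, 0, 0]

/-- `γ_k ↦ γ_k^t`: `t = 0` exchanges `0` and `1`, `t = 1` changes nothing, `t = 2` exchanges
`1` and `2`. -/
def digitPerm : Fin 3 → Equiv.Perm (Fin 3) := ![Equiv.swap 0 1, 1, Equiv.swap 1 2]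

/-- The letter associated with the letter `x`: `t = 0` exchanges `b` and `c`, `t = 1` changes
nothing, `t = 2` exchanges `a` and `b`. -/
def letterPerm : Fin 3 → Equiv.Perm (Fin 3) := ![Equiv.swap 1 2, 1, Equiv.swap 0 1]

end Gasket

/-! The three copies of `SG(n)` in `SG(n + 1)` form a ring: any two of them share one vertex, a
joint. Cut a spanning tree of `SG(n + 1)` into its restrictions to the copies. In each copy, every
vertex is connected to one of the two joints of that copy, so the restriction is a tree or consists
of two trees that separate the joints. Counting edges, the second case occurs in exactly one copy;
conversely, two spanning trees and one such forest always glue to a spanning tree.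

The third corner of the copy with the forest may lie in either tree, and the symmetries of the
triangle show that all three classes of two-tree forests of `SG(n)` have the same size `g(n)`. Hence
`f(n + 1) = 6 * f(n) ^ 2 * g(n)`, and a given copy carries a tree with probability `2 / 3` and each
of its two classes of forests with probability `1 / 6`. This gives the degree probabilities of
`SG(n + 1)` at a vertex `x_γ` of the right copy (the digit `1`), in terms of those of `SG(n)`. The
symmetry of `SG(n)` that takes the digit `t` to `1` replaces the address `γ` by its reduced address,
and the columns of `B` selected by `E_t R e₁` are exactly the three probabilities that occur. -/

namespace Gasket

open SimpleGraph

section Forests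

variable {V : Type*} {G K L : SimpleGraph V} {S : Set V} {p q r x y : V}

lemma mem_of_reachable (hS : K.support ⊆ S) (h : K.Reachable x y) (hx : x ∈ S) : y ∈ S := by
  rcases eq_or_ne y x with rfl | hne
  · exact hx
  · exact hS (mem_support_of_reachable hne h.symm)

lemma induce_reachable_iff (hS : K.support ⊆ S) (x y : S) :
    (K.induce S).Reachable x y ↔ K.Reachable x y := by
  refine ⟨fun h => h.map (Embedding.induce S).toHom, fun ⟨w⟩ => ⟨w.induce S fun z hz => ?_⟩⟩
  classical
  exact mem_of_reachable hS (w.takeUntil z hz).reachable x.2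

lemma induce_isAcyclic_iff (hS : K.support ⊆ S) : (K.induce S).IsAcyclic ↔ K.IsAcyclic := by
  refine ⟨fun h v c hc => ?_, fun h => h.induce S⟩
  have hc_mem : ∀ z ∈ c.support, z ∈ S := fun z hz =>
    hS (mem_support_of_mem_walk_support c hc.not_nil hz)
  refine h (c.induce S hc_mem) (Walk.IsCycle.of_map (f := (Embedding.induce S).toHom) ?_)
  rwa [Walk.map_induce]

lemma edgeSet_eq_image_induce (hS : K.support ⊆ S) :
    K.edgeSet = Sym2.map Subtype.val '' (K.induce S).edgeSet := by
  conv_lhs => rw [← (K.spanningCoe_induce_eq_self S).2 hS]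
  exact edgeSet_map (Function.Embedding.subtype _) _

lemma card_edgeSet_induce (hS : K.support ⊆ S) :
    Nat.card (K.induce S).edgeSet = K.edgeSet.ncard := by
  rw [edgeSet_eq_image_induce hS,
    Set.ncard_image_of_injective _ (Sym2.map.injective Subtype.val_injective),
    Nat.card_coe_set_eq]

lemma finite_edgeSet (hS : K.support ⊆ S) (hfin : S.Finite) : K.edgeSet.Finite := by
  have := hfin.to_subtype
  rw [edgeSet_eq_image_induce hS]
  exact (Set.toFinite _).image _

lemma ncard_edgeSet_iSup {ι : Type*} [Fintype ι] {K : ι → SimpleGraph V}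
    (hfin : ∀ i, (K i).edgeSet.Finite) (hdisj : Pairwise (Function.onFun Disjoint K)) :
    (⨆ i, K i).edgeSet.ncard = ∑ i, (K i).edgeSet.ncard := by
  rw [edgeSet_iSup, Set.ncard_iUnion_of_finite hfin fun i j hij => disjoint_edgeSet.2 (hdisj hij),
    finsum_eq_sum_of_fintype]

lemma finite_setOf_le (hS : G.support ⊆ S) (hfin : S.Finite) : {K | K ≤ G}.Finite := by
  refine Set.Finite.of_finite_image (f := edgeSet) ?_ edgeSet_injective.injOn
  refine (finite_edgeSet hS hfin).finite_subsets.subset ?_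
  rintro _ ⟨K, hK, rfl⟩
  exact edgeSet_mono hK

/-- The subgraphs of `G` that are trees with vertex set `S`. A subgraph keeps all of `V` as its
vertex type; the points outside `S` are isolated as soon as `G.support ⊆ S`. -/
def spanningTrees (G : SimpleGraph V) (S : Set V) : Set (SimpleGraph V) :=
  {K | K ≤ G ∧ K.IsAcyclic ∧ ∀ x ∈ S, ∀ y ∈ S, K.Reachable x y}

/-- The subgraphs of `G` that consist of two trees covering `S`, one containing `p` and the other
one `q`. -/
def twoTreeForests (G : SimpleGraph V) (S : Set V) (p q : V) : Set (SimpleGraph V) :=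
  {K | K ≤ G ∧ K.IsAcyclic ∧ ¬ K.Reachable p q ∧ ∀ x ∈ S, K.Reachable x p ∨ K.Reachable x q}

/-- The subgraphs of `G` that consist of two trees covering `S`, one containing `p` and the other
one `q` and `r`. -/
def isolatingForests (G : SimpleGraph V) (S : Set V) (p q r : V) : Set (SimpleGraph V) :=
  {K ∈ twoTreeForests G S p q | K.Reachable q r}

lemma twoTreeForests_comm : twoTreeForests G S p q = twoTreeForests G S q p := by
  simp only [twoTreeForests, reachable_comm (u := p) (v := q), or_comm]

lemma isolatingForests_comm : isolatingForests G S p q r = isolatingForests G S p r q := by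
  have subset (q r : V) : isolatingForests G S p q r ⊆ isolatingForests G S p r q := by
    rintro K ⟨⟨hle, hacyc, hpq, hcover⟩, hqr⟩
    exact ⟨⟨hle, hacyc, fun hpr => hpq (hpr.trans hqr.symm),
      fun x hx => (hcover x hx).imp_right fun hxq => hxq.trans hqr⟩, hqr.symm⟩
  exact (subset q r).antisymm (subset r q)

lemma finite_spanningTrees (hS : G.support ⊆ S) (hfin : S.Finite) : (spanningTrees G S).Finite :=
  (finite_setOf_le hS hfin).subset fun _ hK => hK.1

lemma finite_twoTreeForests (hS : G.support ⊆ S) (hfin : S.Finite) :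
    (twoTreeForests G S p q).Finite :=
  (finite_setOf_le hS hfin).subset fun _ hK => hK.1

lemma disjoint_spanningTrees_twoTreeForests (hp : p ∈ S) (hq : q ∈ S) :
    Disjoint (spanningTrees G S) (twoTreeForests G S p q) :=
  Set.disjoint_left.2 fun _ htree hforest => hforest.2.2.1 (htree.2.2 p hp q hq)

lemma twoTreeForests_eq_union (hr : r ∈ S) :
    twoTreeForests G S p q = isolatingForests G S p q r ∪ isolatingForests G S q p r := by
  ext K
  constructor
  · intro hK
    refine (hK.2.2.2 r hr).symm.imp (fun h => ⟨hK, h.symm⟩) fun h => ⟨?_, h.symm⟩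
    rwa [twoTreeForests_comm]
  · rintro (hK | hK)
    · exact hK.1
    · rw [twoTreeForests_comm]
      exact hK.1

lemma disjoint_isolatingForests :
    Disjoint (isolatingForests G S p q r) (isolatingForests G S q p r) :=
  Set.disjoint_left.2 fun _ hp hq => hp.1.2.2.1 (hq.2.trans hp.2.symm)

lemma ncard_twoTreeForests_inter (hS : G.support ⊆ S) (hfin : S.Finite) (hr : r ∈ S)
    (D : Set (SimpleGraph V)) :
    (twoTreeForests G S p q ∩ D).ncard =
      (isolatingForests G S p q r ∩ D).ncard + (isolatingForests G S q p r ∩ D).ncard := by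
  have hfinite (p q : V) : (isolatingForests G S p q r ∩ D).Finite :=
    (finite_twoTreeForests hS hfin).subset fun _ hK => hK.1.1
  rw [twoTreeForests_eq_union hr, Set.union_inter_distrib_right,
    Set.ncard_union_eq (disjoint_isolatingForests.mono Set.inter_subset_left
      Set.inter_subset_left) (hfinite p q) (hfinite q p)]

lemma isAcyclic_iff_ncard_edgeSet (hS : K.support ⊆ S) (hfin : S.Finite) (hne : S.Nonempty)
    (hreach : ∀ x ∈ S, ∀ y ∈ S, K.Reachable x y) :
    K.IsAcyclic ↔ K.edgeSet.ncard + 1 = S.ncard := by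
  have := hfin.to_subtype
  have := hne.to_subtype
  have hconn : (K.induce S).Connected :=
    ⟨fun x y => (induce_reachable_iff hS x y).2 (hreach x x.2 y y.2)⟩
  have hcard := isTree_iff_connected_and_card (G := K.induce S)
  rwa [isTree_iff, and_congr_right_iff, imp_iff_right hconn, induce_isAcyclic_iff hS,
    card_edgeSet_induce hS, Nat.card_coe_set_eq] at hcard

lemma ncard_edgeSet_of_mem_spanningTrees (hS : G.support ⊆ S) (hfin : S.Finite)
    (hne : S.Nonempty) (hK : K ∈ spanningTrees G S) : K.edgeSet.ncard + 1 = S.ncard :=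
  (isAcyclic_iff_ncard_edgeSet ((support_mono hK.1).trans hS) hfin hne hK.2.2).1 hK.2.1

lemma sup_edge_mem_spanningTrees (hne : p ≠ q) (hK : K ∈ twoTreeForests G S p q) :
    K ⊔ edge p q ∈ spanningTrees (G ⊔ edge p q) S := by
  obtain ⟨hle, hacyc, hpq, hcover⟩ := hK
  have hqp : (K ⊔ edge p q).Reachable q p :=
    Adj.reachable (Or.inr ((edge_adj ..).2 ⟨Or.inr ⟨rfl, rfl⟩, hne.symm⟩))
  have hreach : ∀ x ∈ S, (K ⊔ edge p q).Reachable x p := fun x hx =>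
    (hcover x hx).elim (fun h => h.mono le_sup_left) fun h => (h.mono le_sup_left).trans hqp
  exact ⟨sup_le_sup_right hle _, hacyc.sup_edge_of_not_reachable hpq,
    fun x hx y hy => (hreach x hx).trans (hreach y hy).symm⟩

lemma ncard_edgeSet_of_mem_twoTreeForests (hS : G.support ⊆ S) (hfin : S.Finite) (hp : p ∈ S)
    (hq : q ∈ S) (hK : K ∈ twoTreeForests G S p q) : K.edgeSet.ncard + 2 = S.ncard := by
  have hne : p ≠ q := fun h => hK.2.2.1 (h ▸ Reachable.rfl)
  have hS' : (G ⊔ edge p q).support ⊆ S := by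
    rintro x ⟨y, h | h⟩
    · exact hS ⟨y, h⟩
    · rcases ((edge_adj ..).1 h).1 with ⟨rfl, -⟩ | ⟨rfl, -⟩ <;> assumption
  have hcard := ncard_edgeSet_of_mem_spanningTrees hS' hfin ⟨p, hp⟩
    (sup_edge_mem_spanningTrees hne hK)
  have hpq : s(p, q) ∉ K.edgeSet := fun h => hK.2.2.1 (Adj.reachable h)
  rwa [edgeSet_sup, edgeSet_edge_of_ne hne, Set.union_singleton, Set.ncard_insert_of_notMem hpq
    (finite_edgeSet ((support_mono hK.1).trans hS) hfin)] at hcard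

lemma card_connectedComponent_induce_eq_two_iff (hS : K.support ⊆ S) (hp : p ∈ S) (hq : q ∈ S)
    (hpq : ¬ K.Reachable p q) :
    Nat.card (K.induce S).ConnectedComponent = 2 ↔
      ∀ x ∈ S, K.Reachable x p ∨ K.Reachable x q := by
  set c := (K.induce S).connectedComponentMk
  have hc (x y : S) : c x = c y ↔ K.Reachable x y :=
    ConnectedComponent.eq.trans (induce_reachable_iff hS x y)
  have hne : c ⟨p, hp⟩ ≠ c ⟨q, hq⟩ := (hc _ _).not.2 hpq
  rw [Nat.card_eq_two_iff' (c ⟨p, hp⟩)]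
  constructor
  · rintro ⟨d, -, hd⟩ x hx
    by_cases hxp : c ⟨x, hx⟩ = c ⟨p, hp⟩
    · exact Or.inl ((hc _ _).1 hxp)
    · exact Or.inr ((hc _ _).1 ((hd _ hxp).trans (hd _ hne.symm).symm))
  · refine fun hcover => ⟨c ⟨q, hq⟩, hne.symm, ConnectedComponent.ind fun x hxp => ?_⟩
    exact (hc _ _).2 ((hcover x x.2).resolve_left fun h => hxp ((hc _ _).2 h))

lemma reachable_or_exists_reachable_mem_support (hS : K.support ⊆ S) (hx : x ∈ S)
    (h : (K ⊔ L).Reachable x y) :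
    K.Reachable x y ∨ ∃ z ∈ S, z ∈ L.support ∧ K.Reachable x z := by
  rw [reachable_iff_reflTransGen] at h
  induction h with
  | refl => exact Or.inl Reachable.rfl
  | tail _ hyz ih =>
    rcases ih with hxy | hexit
    · refine hyz.imp (fun hK => hxy.trans hK.reachable) fun hL => ?_
      exact ⟨_, mem_of_reachable hS hxy hx, ⟨_, hL⟩, hxy⟩
    · exact Or.inr hexit

end Forests

section Counting

lemma iSup_inf_eq_self {α ι : Type*} [Order.Frame α] {a : α} {g : ι → α} (h : a ≤ ⨆ i, g i) :
    ⨆ i, a ⊓ g i = a := by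
  rw [← inf_iSup_eq, inf_eq_left.2 h]

lemma iSup_inf_eq_apply {α ι : Type*} [Order.Frame α] {f g : ι → α}
    (hg : Pairwise (Function.onFun Disjoint g)) (hf : ∀ i, f i ≤ g i) (i : ι) :
    (⨆ j, f j) ⊓ g i = f i := by
  refine le_antisymm ?_ (le_inf (le_iSup f i) (hf i))
  rw [iSup_inf_eq]
  refine iSup_le fun j => ?_
  rcases eq_or_ne j i with rfl | hji
  · exact inf_le_left
  · exact ((hg hji).mono_left (hf j)).le_bot.trans bot_le

lemma ncard_setOf_forall_inf_mem {α ι : Type*} [Order.Frame α] {g : ι → α} {A : Set α}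
    (hg : Pairwise (Function.onFun Disjoint g)) (hA : ∀ a ∈ A, a ≤ ⨆ i, g i) (D : ι → Set α) :
    {a ∈ A | ∀ i, a ⊓ g i ∈ D i}.ncard =
      {f : ι → α | (∀ i, f i ≤ g i) ∧ ⨆ i, f i ∈ A ∧ ∀ i, f i ∈ D i}.ncard := by
  have himage : (fun a i => a ⊓ g i) '' {a ∈ A | ∀ i, a ⊓ g i ∈ D i} =
      {f : ι → α | (∀ i, f i ≤ g i) ∧ ⨆ i, f i ∈ A ∧ ∀ i, f i ∈ D i} := by
    ext f
    constructor
    · rintro ⟨a, ⟨ha, hD⟩, rfl⟩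
      exact ⟨fun i => inf_le_right, by rwa [iSup_inf_eq_self (hA a ha)], hD⟩
    · rintro ⟨hf, hfA, hD⟩
      have hrestrict : (fun i => (⨆ j, f j) ⊓ g i) = f := funext (iSup_inf_eq_apply hg hf)
      exact ⟨⨆ i, f i, ⟨hfA, fun i => congrFun hrestrict i ▸ hD i⟩, hrestrict⟩
  rw [← himage, Set.InjOn.ncard_image]
  intro a ha b hb hab
  rw [← iSup_inf_eq_self (hA a ha.1), ← iSup_inf_eq_self (hA b hb.1)]
  exact congrArg iSup hab

lemma ncard_univ_pi {ι α : Type*} [Fintype ι] (A : ι → Set α) :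
    (Set.univ.pi A).ncard = ∏ i, (A i).ncard := by
  rw [← Nat.card_coe_set_eq, Nat.card_congr (Equiv.Set.univPi A), Nat.card_pi]
  rfl

variable {ι α : Type*} [DecidableEq ι] {S T : ι → Set α}

lemma setOf_exists_mem_forall_ne_mem :
    {f : ι → α | ∃ i, f i ∈ S i ∧ ∀ j ≠ i, f j ∈ T j} =
      ⋃ i, Set.univ.pi (Function.update T i (S i)) := by
  ext f
  simp only [Set.mem_ofPred_eq, Set.mem_iUnion, Set.mem_univ_pi]
  exact exists_congr fun i => (Function.forall_update_iff T (p := fun j A => f j ∈ A)).symm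

lemma ncard_setOf_exists_mem_forall_ne_mem [Fintype ι] (hS : ∀ i, (S i).Finite)
    (hT : ∀ i, (T i).Finite) (hST : ∀ i, Disjoint (S i) (T i)) :
    {f : ι → α | ∃ i, f i ∈ S i ∧ ∀ j ≠ i, f j ∈ T j}.ncard =
      ∑ i, (S i).ncard * ∏ j ∈ {i}ᶜ, (T j).ncard := by
  rw [setOf_exists_mem_forall_ne_mem, Set.ncard_iUnion_of_finite, finsum_eq_sum_of_fintype]
  · refine Finset.sum_congr rfl fun i _ => ?_
    rw [ncard_univ_pi, Fintype.prod_eq_mul_prod_compl i, Function.update_self]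
    exact congrArg _ (Finset.prod_congr rfl fun j hj => by
      rw [Function.update_of_ne (by simpa using hj)])
  · exact fun i => Set.Finite.pi ((Function.forall_update_iff T fun _ A => A.Finite).2
      ⟨hS i, fun j _ => hT j⟩)
  · intro i k hik
    refine Set.disjoint_left.2 fun f hi hk => ?_
    have hfS : f i ∈ S i := by simpa using hi i (Set.mem_univ i)
    have hfT : f i ∈ T i := by simpa [hik] using hk i (Set.mem_univ i)
    exact Set.disjoint_left.1 (hST i) hfS hfT

end Counting

section TriangularGluing

variable {V : Type*} {C : Fin 3 → Set V} {w : Fin 3 → Fin 3 → V} {G K : Fin 3 → SimpleGraph V}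

/-- Three finite graphs `G i`, drawn on vertex sets `C i`, any two of which share exactly one
vertex, the joint `w i j`; the two joints of each piece are different. -/
structure IsTriangularGluing (C : Fin 3 → Set V) (w : Fin 3 → Fin 3 → V)
    (G : Fin 3 → SimpleGraph V) : Prop where
  support_subset : ∀ i, (G i).support ⊆ C i
  finite : ∀ i, (C i).Finite
  inter_eq : ∀ ⦃i j⦄, i ≠ j → C i ∩ C j = {w i j}
  joint_ne : ∀ i, w i (i + 1) ≠ w i (i + 2)

lemma add_one_ne_self (i : Fin 3) : i + 1 ≠ i := by decide +revert

lemma add_two_ne_self (i : Fin 3) : i + 2 ≠ i := by decide +revert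

lemma add_one_ne_add_two (i : Fin 3) : i + 1 ≠ i + 2 := by decide +revert

lemma ne_iff_eq_add_one_or_eq_add_two {i j : Fin 3} : j ≠ i ↔ j = i + 1 ∨ j = i + 2 := by
  decide +revert

lemma sum_eq_add_add {M : Type*} [AddCommMonoid M] (f : Fin 3 → M) (i : Fin 3) :
    ∑ j, f j = f i + f (i + 1) + f (i + 2) := by
  rw [← Equiv.sum_comp (Equiv.addLeft i), Fin.sum_univ_three]
  simp

lemma prod_compl_singleton {M : Type*} [CommMonoid M] (f : Fin 3 → M) (i : Fin 3) :
    ∏ j ∈ {i}ᶜ, f j = f (i + 1) * f (i + 2) := by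
  have hcompl : ({i}ᶜ : Finset (Fin 3)) = {i + 1, i + 2} := by decide +revert
  rw [hcompl, Finset.prod_pair (add_one_ne_add_two i)]

namespace IsTriangularGluing

variable (h : IsTriangularGluing C w G)

include h

lemma joint_mem_left {i j : Fin 3} (hij : i ≠ j) : w i j ∈ C i :=
  ((h.inter_eq hij).ge rfl).1

lemma joint_mem_right {i j : Fin 3} (hij : i ≠ j) : w i j ∈ C j :=
  ((h.inter_eq hij).ge rfl).2

lemma eq_joint {i j : Fin 3} (hij : i ≠ j) {x : V} (hi : x ∈ C i) (hj : x ∈ C j) : x = w i j :=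
  (h.inter_eq hij).le ⟨hi, hj⟩

lemma pairwise_disjoint : Pairwise (Function.onFun Disjoint G) := by
  refine fun i j hij => disjoint_left.2 fun x y hi hj => hi.ne ?_
  rw [h.eq_joint hij (h.support_subset i ⟨y, hi⟩) (h.support_subset j ⟨y, hj⟩),
    h.eq_joint hij (h.support_subset i ⟨x, hi.symm⟩) (h.support_subset j ⟨x, hj.symm⟩)]

lemma neighborSet_inf {L : SimpleGraph V} (hL : L ≤ ⨆ i, G i) {i : Fin 3} {x : V} (hx : x ∈ C i)
    (hne : ∀ j ≠ i, x ≠ w i j) : (L ⊓ G i).neighborSet x = L.neighborSet x := by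
  refine Set.Subset.antisymm (fun _ hy => hy.1) fun y hy => ⟨hy, ?_⟩
  obtain ⟨j, hj⟩ := iSup_adj.1 (hL hy)
  obtain rfl : j = i := by
    by_contra hji
    exact hne j hji (h.eq_joint (Ne.symm hji) hx (h.support_subset j ⟨y, hj⟩))
  exact hj

lemma ncard_iUnion : (⋃ i, C i).ncard + 3 = ∑ i, (C i).ncard := by
  have hUnion : ⋃ i, C i = C 0 ∪ C 1 ∪ C 2 := iSup_fin_three
  have h01 := Set.ncard_union_add_ncard_inter (C 0) (C 1) (h.finite 0) (h.finite 1)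
  have h2 := Set.ncard_union_add_ncard_inter (C 0 ∪ C 1) (C 2) ((h.finite 0).union (h.finite 1))
    (h.finite 2)
  rw [h.inter_eq (by decide), Set.ncard_singleton] at h01
  have hjoint : w 2 0 ≠ w 2 1 := h.joint_ne 2
  rw [← hUnion, Set.inter_comm, Set.inter_union_distrib_left, h.inter_eq (by decide),
    h.inter_eq (by decide), Set.singleton_union, Set.ncard_pair hjoint] at h2
  rw [Fin.sum_univ_three]
  omega

lemma ncard_edgeSet_iSup (hK : ∀ i, K i ≤ G i) :
    (⨆ i, K i).edgeSet.ncard = ∑ i, (K i).edgeSet.ncard :=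
  Gasket.ncard_edgeSet_iSup
    (fun i => finite_edgeSet ((support_mono (hK i)).trans (h.support_subset i)) (h.finite i))
    fun i j hij => (h.pairwise_disjoint hij).mono (hK i) (hK j)

lemma reachable_iSup {i : Fin 3} (hi : ∀ x ∈ C i, ∃ j ≠ i, (K i).Reachable x (w i j))
    (hne : ∀ j ≠ i, ∀ x ∈ C j, ∀ y ∈ C j, (K j).Reachable x y) :
    ∀ x ∈ ⋃ j, C j, ∀ y ∈ ⋃ j, C j, (⨆ j, K j).Reachable x y := by
  obtain ⟨c, hc⟩ : ∃ c, ∀ j ≠ i, c ∈ C j := by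
    refine ⟨w (i + 1) (i + 2), fun j hj => ?_⟩
    rcases ne_iff_eq_add_one_or_eq_add_two.1 hj with rfl | rfl
    · exact h.joint_mem_left (add_one_ne_add_two i)
    · exact h.joint_mem_right (add_one_ne_add_two i)
  have reach_c_of_ne : ∀ j ≠ i, ∀ x ∈ C j, (⨆ j, K j).Reachable x c := fun j hj x hx =>
    (hne j hj x hx c (hc j hj)).mono (le_iSup K j)
  have reach_c : ∀ x ∈ ⋃ j, C j, (⨆ j, K j).Reachable x c := by
    intro x hx
    obtain ⟨j, hx⟩ := Set.mem_iUnion.1 hx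
    rcases eq_or_ne j i with rfl | hj
    · obtain ⟨k, hk, hxk⟩ := hi x hx
      exact (hxk.mono (le_iSup K j)).trans (reach_c_of_ne k hk _ (h.joint_mem_right hk.symm))
    · exact reach_c_of_ne j hj x hx
  exact fun x hx y hy => (reach_c x hx).trans (reach_c y hy).symm

lemma exists_reachable_joint (hK : ∀ i, K i ≤ G i)
    (hreach : ∀ x ∈ ⋃ j, C j, ∀ y ∈ ⋃ j, C j, (⨆ j, K j).Reachable x y) (i : Fin 3) {x : V}
    (hx : x ∈ C i) : ∃ j ≠ i, (K i).Reachable x (w i j) := by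
  have hS (j : Fin 3) : (K j).support ⊆ C j := (support_mono (hK j)).trans (h.support_subset j)
  set c := w (i + 1) (i + 2)
  have hc : c ∈ C (i + 1) := h.joint_mem_left (add_one_ne_add_two i)
  have hxc := hreach x (Set.mem_iUnion_of_mem i hx) c (Set.mem_iUnion_of_mem _ hc)
  rw [iSup_split_single K i] at hxc
  suffices ∃ j ≠ i, ∃ z ∈ C i, z ∈ C j ∧ (K i).Reachable x z by
    obtain ⟨j, hj, z, hzi, hzj, hxz⟩ := this
    exact ⟨j, hj, h.eq_joint hj.symm hzi hzj ▸ hxz⟩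
  rcases reachable_or_exists_reachable_mem_support (hS i) hx hxc with hxc | ⟨z, hz, ⟨y, hy⟩, hxz⟩
  · exact ⟨i + 1, add_one_ne_self i, c, mem_of_reachable (hS i) hxc hx, hc, hxc⟩
  · simp only [iSup_adj] at hy
    obtain ⟨j, hj, hy⟩ := hy
    exact ⟨j, hj, z, hz, hS j ⟨y, hy⟩, hxz⟩

lemma mem_spanningTrees_or_mem_twoTreeForests (hK : ∀ i, K i ≤ G i)
    (htree : ⨆ i, K i ∈ spanningTrees (⨆ i, G i) (⋃ i, C i)) (i : Fin 3) :
    K i ∈ spanningTrees (G i) (C i) ∨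
      K i ∈ twoTreeForests (G i) (C i) (w i (i + 1)) (w i (i + 2)) := by
  have hacyc : (K i).IsAcyclic := htree.2.1.anti (le_iSup K i)
  have hcover : ∀ x ∈ C i,
      (K i).Reachable x (w i (i + 1)) ∨ (K i).Reachable x (w i (i + 2)) := by
    intro x hx
    obtain ⟨j, hj, hxj⟩ := h.exists_reachable_joint hK htree.2.2 i hx
    rcases ne_iff_eq_add_one_or_eq_add_two.1 hj with rfl | rfl
    · exact Or.inl hxj
    · exact Or.inr hxj
  by_cases hjoints : (K i).Reachable (w i (i + 1)) (w i (i + 2))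
  · have hreach : ∀ x ∈ C i, (K i).Reachable x (w i (i + 2)) := fun x hx =>
      (hcover x hx).elim (fun hx => hx.trans hjoints) id
    exact Or.inl ⟨hK i, hacyc, fun x hx y hy => (hreach x hx).trans (hreach y hy).symm⟩
  · exact Or.inr ⟨hK i, hacyc, hjoints, hcover⟩

lemma ncard_edgeSet_of_mem_spanningTrees {i : Fin 3} (hK : K i ∈ spanningTrees (G i) (C i)) :
    (K i).edgeSet.ncard + 1 = (C i).ncard :=
  Gasket.ncard_edgeSet_of_mem_spanningTrees (h.support_subset i) (h.finite i)
    ⟨_, h.joint_mem_left (add_one_ne_self i).symm⟩ hK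

lemma ncard_edgeSet_of_mem_twoTreeForests {i : Fin 3}
    (hK : K i ∈ twoTreeForests (G i) (C i) (w i (i + 1)) (w i (i + 2))) :
    (K i).edgeSet.ncard + 2 = (C i).ncard :=
  Gasket.ncard_edgeSet_of_mem_twoTreeForests (h.support_subset i) (h.finite i)
    (h.joint_mem_left (add_one_ne_self i).symm) (h.joint_mem_left (add_two_ne_self i).symm) hK

lemma isAcyclic_iSup_iff (hK : ∀ i, K i ≤ G i)
    (hreach : ∀ x ∈ ⋃ j, C j, ∀ y ∈ ⋃ j, C j, (⨆ j, K j).Reachable x y) :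
    (⨆ i, K i).IsAcyclic ↔ ∑ i, (K i).edgeSet.ncard + 4 = ∑ i, (C i).ncard := by
  have hS : (⨆ i, K i).support ⊆ ⋃ i, C i := by
    rintro x ⟨y, hxy⟩
    obtain ⟨i, hxy⟩ := iSup_adj.1 hxy
    exact Set.mem_iUnion_of_mem i (h.support_subset i ⟨y, hK i hxy⟩)
  rw [isAcyclic_iff_ncard_edgeSet hS (Set.finite_iUnion h.finite)
    ⟨_, Set.mem_iUnion_of_mem _ (h.joint_mem_left (add_one_ne_self 0).symm)⟩ hreach,
    h.ncard_edgeSet_iSup hK, ← h.ncard_iUnion]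
  omega

theorem iSup_mem_spanningTrees_iff (hK : ∀ i, K i ≤ G i) :
    ⨆ i, K i ∈ spanningTrees (⨆ i, G i) (⋃ i, C i) ↔
      ∃ i, K i ∈ twoTreeForests (G i) (C i) (w i (i + 1)) (w i (i + 2)) ∧
        ∀ j ≠ i, K j ∈ spanningTrees (G j) (C j) := by
  have htree_card (i : Fin 3) (hi : K i ∈ spanningTrees (G i) (C i)) :=
    h.ncard_edgeSet_of_mem_spanningTrees hi
  have hforest_card (i : Fin 3) (hi : K i ∈ twoTreeForests (G i) (C i) _ _) :=
    h.ncard_edgeSet_of_mem_twoTreeForests hi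
  constructor
  · intro htree
    have hpiece := h.mem_spanningTrees_or_mem_twoTreeForests hK htree
    have hcard := (h.isAcyclic_iSup_iff hK htree.2.2).1 htree.2.1
    have hle (i : Fin 3) : (K i).edgeSet.ncard + 1 ≤ (C i).ncard := by
      rcases hpiece i with hi | hi
      · exact (htree_card i hi).le
      · exact (Nat.le_succ _).trans (hforest_card i hi).le
    obtain ⟨i, hi⟩ : ∃ i, K i ∈ twoTreeForests (G i) (C i) (w i (i + 1)) (w i (i + 2)) := by
      by_contra! hnone
      have htrees (i : Fin 3) := htree_card i ((hpiece i).resolve_right (hnone i))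
      rw [Fin.sum_univ_three, Fin.sum_univ_three, ← htrees 0, ← htrees 1, ← htrees 2] at hcard
      omega
    refine ⟨i, hi, fun j hj => (hpiece j).resolve_right fun hjforest => ?_⟩
    have hi := hforest_card i hi
    have hj' := hforest_card j hjforest
    rw [sum_eq_add_add _ i, sum_eq_add_add _ i] at hcard
    have h1 := hle (i + 1)
    have h2 := hle (i + 2)
    rcases ne_iff_eq_add_one_or_eq_add_two.1 hj with rfl | rfl <;> omega
  · rintro ⟨i, hi, hne⟩
    have hreach := h.reachable_iSup (K := K) (i := i)
      (fun x hx => (hi.2.2.2 x hx).elim (fun hx => ⟨_, add_one_ne_self i, hx⟩)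
        fun hx => ⟨_, add_two_ne_self i, hx⟩) fun j hj => (hne j hj).2.2
    refine ⟨iSup_mono hK, (h.isAcyclic_iSup_iff hK hreach).2 ?_, hreach⟩
    rw [sum_eq_add_add _ i, sum_eq_add_add _ i, ← hforest_card i hi,
      ← htree_card _ (hne _ (add_one_ne_self i)), ← htree_card _ (hne _ (add_two_ne_self i))]
    omega

theorem ncard_spanningTrees_inter (D : Fin 3 → Set (SimpleGraph V)) :
    {H ∈ spanningTrees (⨆ i, G i) (⋃ i, C i) | ∀ i, H ⊓ G i ∈ D i}.ncard =
      ∑ i, (twoTreeForests (G i) (C i) (w i (i + 1)) (w i (i + 2)) ∩ D i).ncard *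
        ∏ j ∈ {i}ᶜ, (spanningTrees (G j) (C j) ∩ D j).ncard := by
  have hpieces : {K : Fin 3 → SimpleGraph V | (∀ i, K i ≤ G i) ∧
        ⨆ i, K i ∈ spanningTrees (⨆ i, G i) (⋃ i, C i) ∧ ∀ i, K i ∈ D i} =
      {K : Fin 3 → SimpleGraph V |
        ∃ i, K i ∈ twoTreeForests (G i) (C i) (w i (i + 1)) (w i (i + 2)) ∩ D i ∧
          ∀ j ≠ i, K j ∈ spanningTrees (G j) (C j) ∩ D j} := by
    ext K
    constructor
    · rintro ⟨hK, htree, hD⟩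
      obtain ⟨i, hi, hne⟩ := (h.iSup_mem_spanningTrees_iff hK).1 htree
      exact ⟨i, ⟨hi, hD i⟩, fun j hj => ⟨hne j hj, hD j⟩⟩
    · rintro ⟨i, hi, hne⟩
      have forall_of {p : Fin 3 → Prop} (hpi : p i) (hpne : ∀ j ≠ i, p j) (j : Fin 3) : p j :=
        (eq_or_ne j i).elim (fun hj => hj ▸ hpi) (hpne j)
      have hK := forall_of hi.1.1 fun j hj => (hne j hj).1.1
      exact ⟨hK, (h.iSup_mem_spanningTrees_iff hK).2 ⟨i, hi.1, fun j hj => (hne j hj).1⟩,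
        forall_of hi.2 fun j hj => (hne j hj).2⟩
  rw [ncard_setOf_forall_inf_mem h.pairwise_disjoint fun H hH => hH.1, hpieces,
    ncard_setOf_exists_mem_forall_ne_mem]
  · exact fun i => (finite_twoTreeForests (h.support_subset i) (h.finite i)).subset
      Set.inter_subset_left
  · exact fun i => (finite_spanningTrees (h.support_subset i) (h.finite i)).subset
      Set.inter_subset_left
  · exact fun i => ((disjoint_spanningTrees_twoTreeForests
      (h.joint_mem_left (add_one_ne_self i).symm)
      (h.joint_mem_left (add_two_ne_self i).symm)).mono Set.inter_subset_left
        Set.inter_subset_left).symm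

end IsTriangularGluing
end TriangularGluing

section Transport

variable {V W : Type*} {G K : SimpleGraph V} {S : Set V} {p q r x y : V} (e : V ≃ W)

lemma map_iSup {ι : Sort*} (K : ι → SimpleGraph V) : (⨆ i, K i).map e = ⨆ i, (K i).map e :=
  GaloisConnection.l_iSup (u := SimpleGraph.comap e) fun K L =>
    map_le_iff_le_comap e.toEmbedding K L

lemma map_equiv_bijective : Function.Bijective (SimpleGraph.map e) := by
  refine ⟨map_injective e.toEmbedding, fun L => ⟨L.map e.symm, ?_⟩⟩
  rw [map_map, e.self_comp_symm, map_id]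

lemma map_reachable_iff : (K.map e).Reachable (e x) (e y) ↔ K.Reachable x y :=
  Iso.reachable_iff (φ := Iso.map e K)

lemma map_isAcyclic_iff : (K.map e).IsAcyclic ↔ K.IsAcyclic :=
  (Iso.map e K).isAcyclic_iff.symm

lemma map_le_map_iff : K.map e ≤ G.map e ↔ K ≤ G :=
  (map_le_iff_le_comap e.toEmbedding K _).trans
    (iff_of_eq (congrArg (K ≤ ·) (comap_map_eq e.toEmbedding G)))

lemma preimage_map_spanningTrees :
    SimpleGraph.map e ⁻¹' spanningTrees (G.map e) (e '' S) = spanningTrees G S := by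
  ext K
  simp only [spanningTrees, Set.mem_preimage, Set.mem_ofPred_eq, map_le_map_iff,
    map_isAcyclic_iff, Set.forall_mem_image, map_reachable_iff]

lemma preimage_map_twoTreeForests :
    SimpleGraph.map e ⁻¹' twoTreeForests (G.map e) (e '' S) (e p) (e q) =
      twoTreeForests G S p q := by
  ext K
  simp only [twoTreeForests, Set.mem_preimage, Set.mem_ofPred_eq, map_le_map_iff,
    map_isAcyclic_iff, Set.forall_mem_image, map_reachable_iff]

lemma preimage_map_isolatingForests :
    SimpleGraph.map e ⁻¹' isolatingForests (G.map e) (e '' S) (e p) (e q) (e r) =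
      isolatingForests G S p q r := by
  simp only [isolatingForests, Set.preimage_ofPred_eq, ← Set.mem_preimage,
    preimage_map_twoTreeForests, map_reachable_iff]

end Transport

section Degrees

variable (e : ℤ × ℤ ≃ ℤ × ℤ) (𝒜 : Set (SimpleGraph (ℤ × ℤ))) (j : ℕ) (x : ℤ × ℤ)

lemma deg_map (K : SimpleGraph (ℤ × ℤ)) : deg (K.map e) (e x) = deg K x := by
  rw [deg, deg, ← Set.ncard_image_of_injective (K.neighborSet x) e.injective]
  exact congrArg Set.ncard (K.neighborSet_map e.toEmbedding x)

/-- The number of graphs in `𝒜` that have exactly `j` edges at `x`. -/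
noncomputable def degCount : ℕ := (𝒜 ∩ {K | deg K x = j}).ncard

/-- The proportion of the graphs in `𝒜` that have exactly `j` edges at `x`; it is `0` if `𝒜` is
empty or infinite. -/
noncomputable def degProb : ℚ := degCount 𝒜 j x / 𝒜.ncard

lemma ncard_preimage_map : (SimpleGraph.map e ⁻¹' 𝒜).ncard = 𝒜.ncard :=
  Set.ncard_preimage_of_injective_subset_range (map_equiv_bijective e).1
    fun K _ => (map_equiv_bijective e).2 K

lemma degCount_preimage_map : degCount (SimpleGraph.map e ⁻¹' 𝒜) j x = degCount 𝒜 j (e x) := by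
  simp only [degCount, ← ncard_preimage_map e (𝒜 ∩ {K | deg K (e x) = j}), Set.preimage_inter,
    Set.preimage_ofPred_eq, deg_map]

lemma degProb_preimage_map : degProb (SimpleGraph.map e ⁻¹' 𝒜) j x = degProb 𝒜 j (e x) := by
  rw [degProb, degProb, degCount_preimage_map, ncard_preimage_map]

end Degrees

section Geometry

/-- The corners `o`, `a_n` and `b_n` of `SG(n)`, with indices `0`, `1` and `2`. -/
def corner (n : ℕ) (i : Fin 3) : ℤ × ℤ := (2 ^ n : ℤ) • subOffset i

/-- The translation that carries `SG(n)` onto its copy at the `i`-th corner of `SG(n + 1)`. -/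
def shift (n : ℕ) (i : Fin 3) : ℤ × ℤ ≃ ℤ × ℤ := Equiv.addRight (corner n i)

/-- Barycentric coordinates with respect to the corners of `SG(n)`, scaled to have sum `2 ^ n`. -/
def bary (n : ℕ) (p : ℤ × ℤ) : Fin 3 → ℤ := ![2 ^ n - p.1 - p.2, p.1, p.2]

variable {n : ℕ} {p : ℤ × ℤ} {i j : Fin 3}

lemma corner_zero_right (n : ℕ) : corner n 0 = o := by simp [corner, subOffset, o]

lemma corner_one_right (n : ℕ) : corner n 1 = cornerA n := by simp [corner, subOffset, cornerA]

lemma corner_two_right (n : ℕ) : corner n 2 = cornerB n := by simp [corner, subOffset, cornerB]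

lemma shift_apply (n : ℕ) (i : Fin 3) (p : ℤ × ℤ) : shift n i p = p + corner n i := rfl

lemma shift_corner_self (n : ℕ) (i : Fin 3) : shift n i (corner n i) = corner (n + 1) i := by
  rw [shift_apply, corner, corner, ← two_nsmul, ← natCast_zsmul, smul_smul, pow_succ']
  rfl

lemma bary_injective (n : ℕ) : Function.Injective (bary n) := fun _ _ h =>
  Prod.ext (congrFun h 1) (congrFun h 2)

lemma sum_bary (n : ℕ) (p : ℤ × ℤ) : ∑ i, bary n p i = 2 ^ n := by
  simp only [Fin.sum_univ_three, bary, Matrix.cons_val]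
  ring

lemma bary_shift (n : ℕ) (p : ℤ × ℤ) (d i : Fin 3) :
    bary (n + 1) (shift n d p) i = bary n p i + if i = d then 2 ^ n else 0 := by
  fin_cases d <;> fin_cases i <;> simp [bary, shift_apply, corner, subOffset, pow_succ] <;> ring

lemma bary_corner (n : ℕ) (d i : Fin 3) :
    bary n (corner n d) i = if i = d then 2 ^ n else 0 := by
  fin_cases d <;> fin_cases i <;> simp [bary, corner, subOffset]

lemma corner_injective (n : ℕ) : Function.Injective (corner n) := by
  intro i j hij
  by_contra hne
  have hbary := congrArg (bary n · i) hij
  simp [bary_corner, hne] at hbary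

lemma verts_zero : verts 0 = Set.range (corner 0) := by
  ext p
  simp [verts, Fin.exists_fin_succ, corner, subOffset, eq_comm]

lemma coe_shift_zero (n : ℕ) : ⇑(shift n 0) = id := by
  funext p
  simp [shift_apply, corner, subOffset]

lemma coe_shift_one (n : ℕ) : ⇑(shift n 1) = fun p => p + (2 ^ n, 0) := by
  funext p
  simp [shift_apply, corner, subOffset]

lemma coe_shift_two (n : ℕ) : ⇑(shift n 2) = fun p => p + (0, 2 ^ n) := by
  funext p
  simp [shift_apply, corner, subOffset]

lemma verts_succ (n : ℕ) : verts (n + 1) = ⋃ i, shift n i '' verts n := by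
  rw [← Set.iSup_eq_iUnion, iSup_fin_three, coe_shift_zero, coe_shift_one, coe_shift_two,
    Set.image_id]
  rfl

lemma corner_mem_verts (n : ℕ) (i : Fin 3) : corner n i ∈ verts n := by
  induction n with
  | zero => exact verts_zero ▸ Set.mem_range_self i
  | succ n ih =>
    rw [verts_succ, ← shift_corner_self]
    exact Set.mem_iUnion_of_mem i (Set.mem_image_of_mem _ ih)

lemma finite_verts (n : ℕ) : (verts n).Finite := by
  induction n with
  | zero => exact verts_zero ▸ Set.finite_range _
  | succ n ih => exact verts_succ n ▸ Set.finite_iUnion fun i => ih.image _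

lemma bary_nonneg (hp : p ∈ verts n) (i : Fin 3) : 0 ≤ bary n p i := by
  induction n generalizing p with
  | zero =>
    obtain ⟨d, rfl⟩ := verts_zero.le hp
    rw [bary_corner]
    positivity
  | succ n ih =>
    obtain ⟨d, q, hq, rfl⟩ := Set.mem_iUnion.1 ((verts_succ n).le hp)
    rw [bary_shift]
    have := ih hq
    positivity

lemma eq_corner_of_two_pow_le_bary (hp : p ∈ verts n) (hi : 2 ^ n ≤ bary n p i) :
    p = corner n i := by
  have hsum := sum_bary n p
  have h1 := bary_nonneg hp (i + 1)
  have h2 := bary_nonneg hp (i + 2)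
  rw [sum_eq_add_add _ i] at hsum
  refine bary_injective n (funext fun k => ?_)
  rw [bary_corner]
  split_ifs with hk
  · subst hk
    linarith
  · rcases ne_iff_eq_add_one_or_eq_add_two.1 hk with rfl | rfl <;> linarith

lemma shift_image_inter_shift_image (n : ℕ) (hij : i ≠ j) :
    shift n i '' verts n ∩ shift n j '' verts n = {shift n i (corner n j)} := by
  refine Set.Subset.antisymm ?_ (Set.singleton_subset_iff.2
    ⟨⟨_, corner_mem_verts n j, rfl⟩, _, corner_mem_verts n i, add_comm _ _⟩)
  rintro _ ⟨⟨p, hp, rfl⟩, q, hq, hqp⟩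
  have hbary := congrArg (bary (n + 1) · j) hqp
  simp only [bary_shift, if_neg hij.symm, if_pos] at hbary
  have hpj : p = corner n j :=
    eq_corner_of_two_pow_le_bary hp (by linarith [bary_nonneg hq j])
  rw [hpj, Set.mem_singleton_iff]

lemma SG_zero : SG 0 = (⊤ : SimpleGraph (Fin 3)).map (corner 0) := by
  ext p q
  simp only [SG, fromEdgeSet_adj, map_adj', Set.mem_insert_iff, Set.mem_singleton_iff, Sym2.eq_iff]
  simp [Fin.exists_fin_succ, corner, subOffset]
  grind

lemma SG_succ (n : ℕ) : SG (n + 1) = ⨆ i, (SG n).map (shift n i) := by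
  rw [iSup_fin_three, coe_shift_zero, coe_shift_one, coe_shift_two, map_id]
  rfl

lemma support_SG_subset (n : ℕ) : (SG n).support ⊆ verts n := by
  induction n with
  | zero =>
    rw [SG_zero, verts_zero]
    rintro _ ⟨_, -, i, _, -, rfl, -⟩
    exact Set.mem_range_self i
  | succ n ih =>
    rw [SG_succ, verts_succ]
    rintro x ⟨y, hxy⟩
    obtain ⟨i, hxy⟩ := iSup_adj.1 hxy
    refine Set.mem_iUnion_of_mem i (Set.image_mono ih ?_)
    exact (support_map (shift n i).toEmbedding (SG n)).le ⟨y, hxy⟩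

theorem isTriangularGluing_shift (n : ℕ) :
    IsTriangularGluing (fun i => shift n i '' verts n) (fun i j => shift n i (corner n j))
      (fun i => (SG n).map (shift n i)) where
  support_subset i := (support_map (shift n i).toEmbedding (SG n)).trans_subset
    (Set.image_mono (support_SG_subset n))
  finite _ := (finite_verts n).image _
  inter_eq _ _ := shift_image_inter_shift_image n
  joint_ne i := (shift n i).injective.ne ((corner_injective n).ne (add_one_ne_add_two i))

lemma SG_reachable (n : ℕ) : ∀ x ∈ verts n, ∀ y ∈ verts n, (SG n).Reachable x y := by
  induction n with
  | zero =>
    rw [verts_zero, SG_zero]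
    rintro _ ⟨i, rfl⟩ _ ⟨j, rfl⟩
    exact (connected_top.preconnected i j).map
      (Hom.map (corner 0) ⊤ fun hne => (corner_injective 0).ne hne.ne)
  | succ n ih =>
    have hpiece (i : Fin 3) : ∀ x ∈ shift n i '' verts n, ∀ y ∈ shift n i '' verts n,
        ((SG n).map (shift n i)).Reachable x y := by
      rintro _ ⟨x, hx, rfl⟩ _ ⟨y, hy, rfl⟩
      exact (map_reachable_iff _).2 (ih x hx y hy)
    have h := isTriangularGluing_shift n
    rw [verts_succ, SG_succ]
    exact h.reachable_iSup (i := 0) (fun x hx => ⟨1, by decide, hpiece 0 x hx _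
      (h.joint_mem_left (by decide))⟩) fun i _ => hpiece i

end Geometry

section Symmetry

variable (n : ℕ) (π : Equiv.Perm (Fin 3))

lemma bary_mk_bary (p : ℤ × ℤ) : bary n (bary n p (π 1), bary n p (π 2)) = bary n p ∘ π := by
  have hsum : ∑ i, bary n p (π i) = 2 ^ n := by rw [Equiv.sum_comp π (bary n p), sum_bary]
  rw [Fin.sum_univ_three] at hsum
  funext i
  fin_cases i
  · exact show 2 ^ n - bary n p (π 1) - bary n p (π 2) = bary n p (π 0) by linarith
  · rfl
  · rfl

/-- The affine symmetry of the triangular lattice that permutes the corners of `SG(n)` by `π`. -/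
def sym : ℤ × ℤ ≃ ℤ × ℤ where
  toFun p := (bary n p (π.symm 1), bary n p (π.symm 2))
  invFun p := (bary n p (π 1), bary n p (π 2))
  left_inv p := by
    simp only [bary_mk_bary, Function.comp_apply, Equiv.symm_apply_apply]
    rfl
  right_inv p := by
    simp only [bary_mk_bary, Function.comp_apply, Equiv.apply_symm_apply]
    rfl

lemma bary_sym (p : ℤ × ℤ) (i : Fin 3) : bary n (sym n π p) i = bary n p (π.symm i) :=
  congrFun (bary_mk_bary n π.symm p) i

lemma sym_shift (p : ℤ × ℤ) (i : Fin 3) :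
    sym (n + 1) π (shift n i p) = shift n (π i) (sym n π p) := by
  refine bary_injective (n + 1) (funext fun k => ?_)
  simp only [bary_sym, bary_shift, Equiv.symm_apply_eq]

lemma sym_corner (i : Fin 3) : sym n π (corner n i) = corner n (π i) := by
  refine bary_injective n (funext fun k => ?_)
  simp only [bary_sym, bary_corner, Equiv.symm_apply_eq]

lemma sym_image_verts : sym n π '' verts n = verts n := by
  induction n with
  | zero =>
    have hsym : sym 0 π ∘ corner 0 = corner 0 ∘ π := funext (sym_corner 0 π)
    rw [verts_zero, ← Set.range_comp, hsym, π.surjective.range_comp]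
  | succ n ih =>
    have hsym (i : Fin 3) : sym (n + 1) π '' (shift n i '' verts n) = shift n (π i) '' verts n := by
      conv_rhs => rw [← ih]
      simp only [Set.image_image, sym_shift]
    simp only [verts_succ, Set.image_iUnion, hsym]
    exact π.iSup_comp (g := fun i => shift n i '' verts n)

lemma map_sym_SG : (SG n).map (sym n π) = SG n := by
  induction n with
  | zero =>
    have hsym : sym 0 π ∘ corner 0 = corner 0 ∘ π := funext (sym_corner 0 π)
    have htop : (⊤ : SimpleGraph (Fin 3)).map π = ⊤ :=
      (comap_symm ⊤ π).symm.trans (comap_top π.symm.injective)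
    rw [SG_zero, map_map, hsym, ← map_map, htop]
  | succ n ih =>
    have hsym (i : Fin 3) :
        ((SG n).map (shift n i)).map (sym (n + 1) π) = (SG n).map (shift n (π i)) := by
      conv_rhs => rw [← ih]
      rw [map_map, map_map]
      exact congrArg (SimpleGraph.map · (SG n)) (funext fun p => sym_shift n π p i)
    simp only [SG_succ, map_iSup, hsym]
    exact π.iSup_comp (g := fun i => (SG n).map (shift n i))

lemma tilde_eq_sym (p : ℤ × ℤ) : tilde p = sym n (Equiv.swap 1 2) p := by
  simp [tilde, sym, bary]

lemma hat_eq_sym (p : ℤ × ℤ) : hat n p = sym n (Equiv.swap 0 2) p := by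
  have hswap : Equiv.swap (0 : Fin 3) 2 1 = 1 := by decide
  simp [hat, sym, bary, hswap]

end Symmetry

section Recursion

variable (n : ℕ)

/-- The spanning trees of `SG(n)`. -/
def trees : Set (SimpleGraph (ℤ × ℤ)) := spanningTrees (SG n) (verts n)

/-- The spanning subgraphs of `SG(n)` that consist of two trees, one of which contains the `k`-th
corner and the other one the remaining two corners. -/
def cuts (k : Fin 3) : Set (SimpleGraph (ℤ × ℤ)) :=
  isolatingForests (SG n) (verts n) (corner n k) (corner n (k + 1)) (corner n (k + 2))

lemma isolatingForests_corner_eq_cuts {k a b : Fin 3} (ha : a ≠ k) (hb : b ≠ k) (hab : a ≠ b) :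
    isolatingForests (SG n) (verts n) (corner n k) (corner n a) (corner n b) = cuts n k := by
  rcases ne_iff_eq_add_one_or_eq_add_two.1 ha with rfl | rfl <;>
    rcases ne_iff_eq_add_one_or_eq_add_two.1 hb with rfl | rfl
  · exact absurd rfl hab
  · rfl
  · exact isolatingForests_comm
  · exact absurd rfl hab

lemma setOf_isSpanningTree : {K | IsSpanningTree n K} = trees n := by
  ext K
  refine and_congr_right fun hle => ?_
  have hS : K.support ⊆ verts n := (support_mono hle).trans (support_SG_subset n)
  have : Nonempty (verts n) := ⟨⟨_, corner_mem_verts n 0⟩⟩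
  rw [isTree_iff, induce_isAcyclic_iff hS, and_comm, connected_iff, and_iff_left this]
  simp only [Preconnected, induce_reachable_iff hS, Subtype.forall]

lemma setOf_isTwoForest : {K | IsTwoForest n K} = cuts n 2 := by
  have hcorner := corner_mem_verts n
  rw [← isolatingForests_corner_eq_cuts n (k := 2) (a := 0) (b := 1) (by decide) (by decide)
    (by decide), corner_zero_right, corner_one_right, corner_two_right]
  ext K
  have hsupport (hle : K ≤ SG n) : K.support ⊆ verts n :=
    (support_mono hle).trans (support_SG_subset n)
  have htwo (hle : K ≤ SG n) (hsep : ¬K.Reachable (cornerB n) o) :=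
    card_connectedComponent_induce_eq_two_iff (hsupport hle)
      (corner_two_right n ▸ hcorner 2) (corner_zero_right n ▸ hcorner 0) hsep
  constructor
  · rintro ⟨⟨hle, hacyc, hcard⟩, hreach, hsep⟩
    rw [reachable_comm] at hsep
    exact ⟨⟨hle, (induce_isAcyclic_iff (hsupport hle)).1 hacyc, hsep, (htwo hle hsep).1 hcard⟩,
      hreach⟩
  · rintro ⟨⟨hle, hacyc, hsep, hcover⟩, hreach⟩
    exact ⟨⟨hle, (induce_isAcyclic_iff (hsupport hle)).2 hacyc, (htwo hle hsep).2 hcover⟩, hreach,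
      fun h => hsep h.symm⟩

lemma preimage_map_sym_trees (π : Equiv.Perm (Fin 3)) :
    SimpleGraph.map (sym n π) ⁻¹' trees n = trees n := by
  have hpreimage := preimage_map_spanningTrees (G := SG n) (S := verts n) (sym n π)
  rwa [map_sym_SG, sym_image_verts] at hpreimage

lemma preimage_map_sym_cuts (π : Equiv.Perm (Fin 3)) (k : Fin 3) :
    SimpleGraph.map (sym n π) ⁻¹' cuts n (π k) = cuts n k := by
  have hpreimage := preimage_map_isolatingForests (G := SG n) (S := verts n) (p := corner n k)
    (q := corner n (k + 1)) (r := corner n (k + 2)) (sym n π)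
  rwa [map_sym_SG, sym_image_verts, sym_corner, sym_corner, sym_corner,
    isolatingForests_corner_eq_cuts n (π.injective.ne (add_one_ne_self k))
      (π.injective.ne (add_two_ne_self k)) (π.injective.ne (add_one_ne_add_two k))] at hpreimage

lemma degProb_trees_sym (π : Equiv.Perm (Fin 3)) (j : ℕ) (x : ℤ × ℤ) :
    degProb (trees n) j (sym n π x) = degProb (trees n) j x := by
  rw [← degProb_preimage_map, preimage_map_sym_trees]

lemma degProb_cuts_sym (π : Equiv.Perm (Fin 3)) (k : Fin 3) (j : ℕ) (x : ℤ × ℤ) :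
    degProb (cuts n (π k)) j (sym n π x) = degProb (cuts n k) j x := by
  rw [← degProb_preimage_map, preimage_map_sym_cuts]

lemma ncard_cuts (k : Fin 3) : (cuts n k).ncard = (cuts n 2).ncard := by
  rw [← preimage_map_sym_cuts n (Equiv.swap k 2), Equiv.swap_apply_left, ncard_preimage_map]

lemma ncard_twoTreeForests_corner_inter (i : Fin 3) (D : Set (SimpleGraph (ℤ × ℤ))) :
    (twoTreeForests (SG n) (verts n) (corner n (i + 1)) (corner n (i + 2)) ∩ D).ncard =
      (cuts n (i + 1) ∩ D).ncard + (cuts n (i + 2) ∩ D).ncard := by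
  rw [ncard_twoTreeForests_inter (support_SG_subset n) (finite_verts n) (corner_mem_verts n i),
    isolatingForests_corner_eq_cuts n (add_one_ne_add_two i).symm (add_one_ne_self i).symm
      (add_two_ne_self i),
    isolatingForests_corner_eq_cuts n (add_one_ne_add_two i) (add_two_ne_self i).symm
      (add_one_ne_self i)]

theorem ncard_trees_succ_inter (D : Fin 3 → Set (SimpleGraph (ℤ × ℤ))) :
    {H ∈ trees (n + 1) | ∀ i, H ⊓ (SG n).map (shift n i) ∈ D i}.ncard =
      ∑ i, ((cuts n (i + 1) ∩ SimpleGraph.map (shift n i) ⁻¹' D i).ncard +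
          (cuts n (i + 2) ∩ SimpleGraph.map (shift n i) ⁻¹' D i).ncard) *
        ∏ j ∈ {i}ᶜ, (trees n ∩ SimpleGraph.map (shift n j) ⁻¹' D j).ncard := by
  rw [trees, SG_succ, verts_succ, (isTriangularGluing_shift n).ncard_spanningTrees_inter]
  have hforest (i : Fin 3) :
      (twoTreeForests ((SG n).map (shift n i)) (shift n i '' verts n)
          (shift n i (corner n (i + 1))) (shift n i (corner n (i + 2))) ∩ D i).ncard =
        (cuts n (i + 1) ∩ SimpleGraph.map (shift n i) ⁻¹' D i).ncard +
          (cuts n (i + 2) ∩ SimpleGraph.map (shift n i) ⁻¹' D i).ncard := by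
    rw [← ncard_twoTreeForests_corner_inter, ← ncard_preimage_map (shift n i) (_ ∩ D i),
      Set.preimage_inter, preimage_map_twoTreeForests]
  have htree (i : Fin 3) :
      (spanningTrees ((SG n).map (shift n i)) (shift n i '' verts n) ∩ D i).ncard =
        (trees n ∩ SimpleGraph.map (shift n i) ⁻¹' D i).ncard := by
    rw [← ncard_preimage_map (shift n i) (_ ∩ D i), Set.preimage_inter,
      preimage_map_spanningTrees, trees]
  simp only [hforest, htree]

theorem ncard_trees_succ_inter_single (d : Fin 3) (D : Set (SimpleGraph (ℤ × ℤ))) :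
    {H ∈ trees (n + 1) | H ⊓ (SG n).map (shift n d) ∈ D}.ncard =
      (trees n).ncard ^ 2 * ((cuts n (d + 1) ∩ SimpleGraph.map (shift n d) ⁻¹' D).ncard +
          (cuts n (d + 2) ∩ SimpleGraph.map (shift n d) ⁻¹' D).ncard) +
        4 * (trees n).ncard * (cuts n 2).ncard *
          (trees n ∩ SimpleGraph.map (shift n d) ⁻¹' D).ncard := by
  have hcount := ncard_trees_succ_inter n (Function.update (fun _ => Set.univ) d D)
  have hcond (H : SimpleGraph (ℤ × ℤ)) :
      (∀ i, H ⊓ (SG n).map (shift n i) ∈ Function.update (fun _ => Set.univ) d D i) ↔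
        H ⊓ (SG n).map (shift n d) ∈ D := by
    rw [Function.forall_update_iff _ fun i A => H ⊓ (SG n).map (shift n i) ∈ A]
    simp only [Set.mem_univ, implies_true, and_true]
  simp only [hcond, sum_eq_add_add _ d, prod_compl_singleton, add_assoc, Fin.reduceAdd,
    add_zero, Function.update_self, Function.update_of_ne (add_one_ne_self d),
    Function.update_of_ne (add_two_ne_self d), Set.preimage_univ, Set.inter_univ,
    ncard_cuts n d, ncard_cuts n (d + 1), ncard_cuts n (d + 2)] at hcount
  rw [hcount]
  ring

lemma ncard_trees_succ :
    (trees (n + 1)).ncard = 6 * (trees n).ncard ^ 2 * (cuts n 2).ncard := by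
  have hcount := ncard_trees_succ_inter_single n 0 Set.univ
  simp only [Set.mem_univ, and_true, Set.preimage_univ, Set.inter_univ, Set.ofPred_mem_eq,
    ncard_cuts] at hcount
  rw [hcount]
  ring

lemma ncard_trees_pos : 0 < (trees n).ncard := by
  obtain ⟨K, hle, hacyc, hreach⟩ := (SG n).exists_isAcyclic_reachable_eq_le
  have hK : K ∈ trees n :=
    ⟨hle, hacyc, fun x hx y hy => hreach ▸ SG_reachable n x hx y hy⟩
  exact (Set.ncard_pos (finite_spanningTrees (support_SG_subset n) (finite_verts n))).2 ⟨K, hK⟩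

lemma ncard_cuts_two_pos : 0 < (cuts n 2).ncard :=
  Nat.pos_of_mul_pos_left (ncard_trees_succ n ▸ ncard_trees_pos (n + 1))

variable {n} {x : ℤ × ℤ}

lemma deg_inf_map_shift {K : SimpleGraph (ℤ × ℤ)} (hK : K ≤ SG (n + 1)) (hx : x ∈ verts n)
    (hcorner : ∀ i, x ≠ corner n i) (d : Fin 3) :
    deg (K ⊓ (SG n).map (shift n d)) (shift n d x) = deg K (shift n d x) :=
  congrArg Set.ncard <| (isTriangularGluing_shift n).neighborSet_inf (SG_succ n ▸ hK)
    (Set.mem_image_of_mem _ hx) fun i _ => (shift n d).injective.ne (hcorner i)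

lemma degCount_trees_succ (hx : x ∈ verts n) (hcorner : ∀ i, x ≠ corner n i) (d : Fin 3) (j : ℕ) :
    degCount (trees (n + 1)) j (shift n d x) =
      (trees n).ncard ^ 2 * (degCount (cuts n (d + 1)) j x + degCount (cuts n (d + 2)) j x) +
        4 * (trees n).ncard * (cuts n 2).ncard * degCount (trees n) j x := by
  have hcount := ncard_trees_succ_inter_single n d {K | deg K (shift n d x) = j}
  simp only [Set.preimage_ofPred_eq, deg_map] at hcount
  rw [degCount, degCount, degCount, degCount, ← hcount]
  refine congrArg Set.ncard (Set.ext fun K => and_congr_right fun hK => ?_)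
  rw [Set.mem_ofPred_eq, Set.mem_ofPred_eq, deg_inf_map_shift hK.1 hx hcorner]

theorem degProb_trees_succ (hx : x ∈ verts n) (hcorner : ∀ i, x ≠ corner n i) (d : Fin 3)
    (j : ℕ) :
    degProb (trees (n + 1)) j (shift n d x) = 2 / 3 * degProb (trees n) j x +
      1 / 6 * (degProb (cuts n (d + 1)) j x + degProb (cuts n (d + 2)) j x) := by
  have htrees : ((trees n).ncard : ℚ) ≠ 0 := by exact_mod_cast (ncard_trees_pos n).ne'
  have hcuts : ((cuts n 2).ncard : ℚ) ≠ 0 := by exact_mod_cast (ncard_cuts_two_pos n).ne'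
  simp only [degProb, degCount_trees_succ hx hcorner, ncard_trees_succ, ncard_cuts n (d + 1),
    ncard_cuts n (d + 2)]
  push_cast
  field_simp
  ring

lemma F_eq_degProb (j n : ℕ) (x : ℤ × ℤ) : F j n x = degProb (trees n) j x := by
  rw [degProb, degCount, ← setOf_isSpanningTree]
  rfl

lemma G_eq_degProb (j n : ℕ) (x : ℤ × ℤ) : G j n x = degProb (cuts n 2) j x := by
  rw [degProb, degCount, ← setOf_isTwoForest]
  rfl

lemma G_tilde (j n : ℕ) (x : ℤ × ℤ) : G j n (tilde x) = degProb (cuts n 1) j x := by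
  rw [G_eq_degProb, tilde_eq_sym n]
  exact degProb_cuts_sym n (Equiv.swap 1 2) 1 j x

lemma G_hat (j n : ℕ) (x : ℤ × ℤ) : G j n (hat n x) = degProb (cuts n 0) j x := by
  rw [G_eq_degProb, hat_eq_sym n]
  exact degProb_cuts_sym n (Equiv.swap 0 2) 0 j x

end Recursion

section Vertices

variable {m : ℕ} {γ : List (Fin 3)}

lemma vertex_cons (x : Fin 3) (m : ℕ) (d : Fin 3) (γ : List (Fin 3)) :
    vertex x (m + 1) (d :: γ) = shift (m + 1) d (vertex x m γ) := by
  rw [vertex, shift_apply, corner, add_comm]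

/-- The letters `a`, `b`, `c` belong to the sides opposite to `b_n`, `a_n`, `o`, in this order, so
the side of the letter `x` is opposite to the corner with index `x.rev`. -/
lemma vertex_nil (x : Fin 3) (m : ℕ) :
    vertex x m [] = shift m (x.rev + 1) (corner m (x.rev + 2)) := by
  fin_cases x <;> simp [vertex, shift_apply, corner, sideMid, subOffset, Fin.rev]

lemma bary_vertex_nil (x : Fin 3) (m : ℕ) (i : Fin 3) :
    bary (m + 1) (vertex x m []) i = if i = x.rev then 0 else 2 ^ m := by
  rw [vertex_nil, bary_shift, bary_corner]
  rcases eq_or_ne i x.rev with rfl | hi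
  · simp
  · rcases ne_iff_eq_add_one_or_eq_add_two.1 hi with rfl | rfl <;> simp

lemma rev_letterPerm (t x : Fin 3) : (letterPerm t x).rev = digitPerm t x.rev := by
  decide +revert

lemma vertex_mem_verts (x : Fin 3) (h : γ.length ≤ m) : vertex x m γ ∈ verts (m + 1) := by
  rw [verts_succ]
  induction γ generalizing m with
  | nil =>
    rw [vertex_nil]
    exact Set.mem_iUnion_of_mem _ (Set.mem_image_of_mem _ (corner_mem_verts m _))
  | cons d γ ih =>
    obtain ⟨m, rfl⟩ := Nat.exists_eq_add_of_le' (Nat.one_le_of_lt h)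
    rw [vertex_cons]
    refine Set.mem_iUnion_of_mem d (Set.mem_image_of_mem _ ?_)
    rw [verts_succ]
    exact ih (Nat.le_of_succ_le_succ h)

lemma bary_vertex_lt (x i : Fin 3) (h : γ.length ≤ m) :
    bary (m + 1) (vertex x m γ) i < 2 ^ (m + 1) := by
  have hpow : (0 : ℤ) < 2 ^ m := by positivity
  induction γ generalizing m with
  | nil =>
    rw [bary_vertex_nil, pow_succ]
    split_ifs <;> linarith
  | cons d γ ih =>
    obtain ⟨m, rfl⟩ := Nat.exists_eq_add_of_le' (Nat.one_le_of_lt h)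
    have hlt := ih (Nat.le_of_succ_le_succ h) (by positivity)
    rw [vertex_cons, bary_shift, pow_succ _ (m + 1)]
    split_ifs <;> linarith

lemma vertex_ne_corner (x i : Fin 3) (h : γ.length ≤ m) : vertex x m γ ≠ corner (m + 1) i := by
  intro hvertex
  have hlt := bary_vertex_lt x i h
  simp [hvertex, bary_corner] at hlt

lemma sym_vertex (t x : Fin 3) (h : γ.length ≤ m) :
    sym (m + 1) (digitPerm t) (vertex x m γ) =
      vertex (letterPerm t x) m (γ.map (digitPerm t)) := by
  induction γ generalizing m with
  | nil =>
    refine bary_injective (m + 1) (funext fun i => ?_)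
    simp only [bary_sym, bary_vertex_nil, List.map_nil, rev_letterPerm, Equiv.symm_apply_eq]
  | cons d γ ih =>
    obtain ⟨m, rfl⟩ := Nat.exists_eq_add_of_le' (Nat.one_le_of_lt h)
    rw [vertex_cons, sym_shift, ih (Nat.le_of_succ_le_succ h), ← vertex_cons, List.map_cons]

lemma submatrix_B_mul_E_mul_R_mulVec_e₁ (j m : ℕ) (γ : List (Fin 3)) (t x : Fin 3)
    (σ : Fin 3 → Fin 3) :
    ((B j (m + 1) m γ).submatrix σ id * E t * R).mulVec e₁ x =
      2 / 3 * degProb (trees (m + 1)) j (vertex (σ x) m γ) +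
        1 / 6 * (degProb (cuts (m + 1) (digitPerm t 2)) j (vertex (σ x) m γ) +
          degProb (cuts (m + 1) (digitPerm t 0)) j (vertex (σ x) m γ)) := by
  simp only [Matrix.mulVec, dotProduct, Matrix.mul_apply, Matrix.submatrix_apply, B,
    Fin.sum_univ_five, Matrix.of_apply, F_eq_degProb, G_tilde, G_hat]
  simp only [G_eq_degProb]
  fin_cases t <;> simp [E, R, e₁, digitPerm, Equiv.swap_apply_of_ne_of_ne] <;> ring

end Vertices

end Gasket

open Gasket in
/-- Here `γ = (n, 1, t, γ₄, …, γ_s)` with `t = γ₃`, `δ = (γ₄, …, γ_s)` and `s = δ.length + 3`. -/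
theorem mainTheorem7 (n : ℕ) (hn : 2 ≤ n) (t : Fin 3) (δ : List (Fin 3))
    (hδ : δ.length + 3 ≤ n + 1) (j : ℕ) (hj : 1 ≤ j ∧ j ≤ 4) :
    (fun x : Fin 3 => Gasket.F j (n + 1) (Gasket.vertex x n (1 :: t :: δ))) =
      ((Gasket.B j n (n - 1) (1 :: δ.map (Gasket.digitPerm t))).submatrix
          (Gasket.letterPerm t) id * Gasket.E t * Gasket.R).mulVec Gasket.e₁ := by
  obtain ⟨m, rfl⟩ : ∃ m, n = m + 1 := ⟨n - 1, by omega⟩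
  have hlen : (t :: δ).length ≤ m := by rw [List.length_cons]; omega
  have hdigit : digitPerm t t = 1 := by clear hδ hlen; decide +revert
  funext x
  have hvertex : vertex (letterPerm t x) m (1 :: δ.map (digitPerm t)) =
      sym (m + 1) (digitPerm t) (vertex x m (t :: δ)) := by
    rw [sym_vertex t x hlen, List.map_cons, hdigit]
  calc F j (m + 1 + 1) (vertex x (m + 1) (1 :: t :: δ))
    _ = degProb (trees (m + 1 + 1)) j (shift (m + 1) 1 (vertex x m (t :: δ))) := by
      rw [F_eq_degProb, vertex_cons]
    _ = 2 / 3 * degProb (trees (m + 1)) j (vertex x m (t :: δ)) +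
        1 / 6 * (degProb (cuts (m + 1) 2) j (vertex x m (t :: δ)) +
          degProb (cuts (m + 1) 0) j (vertex x m (t :: δ))) :=
      degProb_trees_succ (vertex_mem_verts x hlen) (fun i => vertex_ne_corner x i hlen) 1 j
    _ = _ := by
      rw [Nat.add_sub_cancel, submatrix_B_mul_E_mul_R_mulVec_e₁, hvertex, degProb_trees_sym,
        degProb_cuts_sym, degProb_cuts_sym]
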